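/- Let $R$ be a Gorenstein local ring of Krull dimension $1$, that is, a commutative Noetherian local ring of Krull dimension $1$ that has finite injective dimension as a module over itself. Let $Q(R)$ be the total ring of fractions of $R$ (the localization of $R$ at the set of all its non-zero-divisors), and let $R\subseteq S\subseteq Q(R)$ be a finite birational extension, that is, $S$ is a subring of $Q(R)$ which contains $R$ and is finitely generated as an $R$-module. Let $\mathfrak c_R(S)=(R:_{Q(R)}S)=\{a\in Q(R): aS\subseteq R\}$ be the conductor of $S$ in $R$, which is an ideal of $R$. Then the following are equivalent: 1. $S$ is a Gorenstein ring, that is, $S$ is Noetherian and for every maximal ideal $\mathfrak m$ of $S$ the local ring $S_{\mathfrak m}$ has finite injective dimension as a module over itself; 2. $S\cong \operatorname{Hom}_R(S,R)$ as $R$-modules; 3. $\mathfrak c_R(S)$ is a stable ideal of $R$, that is, $\mathfrak c_R(S)$ contains a non-zero-divisor of $R$ and $\mathfrak c_R(S)\cong\operatorname{Hom}_R(\mathfrak c_R(S),\mathfrak c_R(S))$ as $R$-modules. -/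

import Mathlib

open CategoryTheory

universe u v

/-- A Gorenstein local ring: a Noetherian local ring that has finite injective dimension as a
module over itself. -/
structure IsGorensteinLocalRing (R : Type u) [CommRing R] : Prop where
  isLocalRing : IsLocalRing R
  isNoetherianRing : IsNoetherianRing R
  finite_injectiveDimension : ∃ n : ℕ, HasInjectiveDimensionLE (ModuleCat.of R R) n

/-- A (not necessarily local) Gorenstein ring: a Noetherian ring all of whose localizations at
maximal ideals are Gorenstein local rings. -/
structure IsGorensteinRing (A : Type u) [CommRing A] : Prop where
  isNoetherianRing : IsNoetherianRing A
  localization (m : Ideal A) [m.IsMaximal] : IsGorensteinLocalRing (Localization.AtPrime m)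

/-- A stable ideal: an ideal `I` that contains a non-zero-divisor and is isomorphic, as an
`R`-module, to `Hom_R(I, I)`. -/
structure IsStableIdeal {R : Type u} [CommRing R] (I : Ideal R) : Prop where
  regular : ∃ x ∈ I, x ∈ nonZeroDivisors R
  iso : Nonempty (I ≃ₗ[R] (I →ₗ[R] I))

section Conductor

variable {R : Type u} [CommRing R] {Q : Type v} [CommRing Q] [Algebra R Q]

/-- The conductor `(R :_Q S) = {a ∈ Q | a S ⊆ R}` of `S` in `R`, as an ideal of `R`; here
`1 : Submodule R Q` is the image of `R` in `Q`. See `map_birationalConductor`. -/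
def birationalConductor (S : Subalgebra R Q) : Ideal R :=
  ((1 : Submodule R Q) / Subalgebra.toSubmodule S).comap (Algebra.linearMap R Q)

/-- All of `(R :_Q S)` lies in the image of `R`, so nothing is lost in the pullback to `R`. -/
theorem map_birationalConductor (S : Subalgebra R Q) :
    Submodule.map (Algebra.linearMap R Q) (birationalConductor S) =
      (1 : Submodule R Q) / Subalgebra.toSubmodule S := by
  rw [birationalConductor, Submodule.map_comap_eq, inf_eq_right, ← Submodule.one_eq_range]
  intro a ha
  have h := Submodule.mem_div_iff_forall_mul_mem.1 ha 1 (one_mem S)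
  rwa [mul_one] at h

end Conductor

/-! The Gorenstein condition is traded for a duality of ideals: `IsDivisorialAt y` says that ideals
containing y equal their double annihilator modulo y. A Gorenstein ring has this at every
non-zero-divisor y that lies only in maximal primes (`isDivisorialAt_of_extVanishes` locally,
`isDivisorialAt_of_localization` globally). Conversely, let A be Noetherian with duality at all
powers of a non-zero-divisor x in its Jacobson radical. Then 0 → A → A[1/x] → A[1/x]/A → 0 is an
injective resolution, so A has injective dimension at most 1
(`IsDivisorialAt.hasInjectiveDimensionLE`).

Write C = R : S. Clearing denominators turns duality into R : (R : F) = F for regular fractional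
ideals F (`one_div_one_div_le`), whence C : C = R : C = S. Linear maps between such ideals are
multiplications, so Hom(S, R) ≅ C and Hom(C, C) ≅ S, and conditions 2 and 3 both say S ≅ C.

If S ≅ C, then C = Sq with q a unit of Q, so R : I = q(S : I) for ideals I of S, and duality passes
from R to S. If S is Gorenstein, the S-dual of C(S : C) is C : C = S, so C(S : C) = S by duality
over S. Thus C is invertible, hence principal because S is semilocal. -/

/-! ### Vanishing of Ext with values in the ring -/

section ExtVanishing

open Abelian

variable {A : Type u} [CommRing A]
  {M N P : Type u} [AddCommGroup M] [AddCommGroup N] [AddCommGroup P]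
  [Module A M] [Module A N] [Module A P] {f : M →ₗ[A] N} {g : N →ₗ[A] P}

variable (A M) in
/-- `Ext^n(M, A) = 0`. -/
def ExtVanishes (n : ℕ) : Prop :=
  Subsingleton (Ext (ModuleCat.of A M) (ModuleCat.of A A) n)

/-- The short complex in `ModuleCat` given by an exact pair of linear maps. -/
abbrev moduleShortComplex (hfg : Function.Exact f g) : ShortComplex (ModuleCat.{u} A) :=
  ShortComplex.mk (ModuleCat.ofHom f) (ModuleCat.ofHom g)
    (by ext x; exact hfg.apply_apply_eq_zero x)

theorem moduleShortComplex_shortExact (hf : Function.Injective f) (hg : Function.Surjective g)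
    (hfg : Function.Exact f g) : (moduleShortComplex hfg).ShortExact :=
  ModuleCat.shortComplex_shortExact _ hfg hf hg

namespace ExtVanishes

theorem middle (hf : Function.Injective f) (hg : Function.Surjective g)
    (hfg : Function.Exact f g) {n : ℕ} (hM : ExtVanishes A M n) (hP : ExtVanishes A P n) :
    ExtVanishes A N n := by
  refine subsingleton_of_forall_eq 0 fun e => ?_
  obtain ⟨e', rfl⟩ := Ext.contravariant_sequence_exact₂
    (moduleShortComplex_shortExact hf hg hfg) (ModuleCat.of A A) e (hM.elim _ _)
  rw [hP.elim e' 0, Ext.comp_zero]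

theorem left (hf : Function.Injective f) (hg : Function.Surjective g)
    (hfg : Function.Exact f g) {n : ℕ} (hN : ExtVanishes A N n) (hP : ExtVanishes A P (n + 1)) :
    ExtVanishes A M n := by
  refine subsingleton_of_forall_eq 0 fun e => ?_
  obtain ⟨e', rfl⟩ := Ext.contravariant_sequence_exact₁
    (moduleShortComplex_shortExact hf hg hfg) (ModuleCat.of A A) e (add_comm 1 n) (hP.elim _ _)
  rw [hN.elim e' 0, Ext.comp_zero]

theorem right (hf : Function.Injective f) (hg : Function.Surjective g)
    (hfg : Function.Exact f g) {n : ℕ} (hM : ExtVanishes A M n) (hN : ExtVanishes A N (n + 1)) :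
    ExtVanishes A P (n + 1) := by
  refine subsingleton_of_forall_eq 0 fun e => ?_
  obtain ⟨e', rfl⟩ := Ext.contravariant_sequence_exact₃
    (moduleShortComplex_shortExact hf hg hfg) (ModuleCat.of A A) e (hN.elim _ _) (add_comm 1 n)
  rw [hM.elim e' 0, Ext.comp_zero]

theorem of_equiv (e : M ≃ₗ[A] N) {n : ℕ} (hM : ExtVanishes A M n) : ExtVanishes A N n := by
  refine subsingleton_of_forall_eq 0 fun x => ?_
  have h : x = (Ext.mk₀ (ModuleCat.ofHom e.symm.toLinearMap)).comp
      ((Ext.mk₀ (ModuleCat.ofHom e.toLinearMap)).comp x (zero_add n)) (zero_add n) := by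
    rw [Ext.mk₀_comp_mk₀_assoc, ← ModuleCat.ofHom_comp, LinearEquiv.comp_symm]
    simp
  rw [h, hM.elim (Ext.comp _ x _) 0, Ext.comp_zero]

theorem self_succ (n : ℕ) : ExtVanishes A A (n + 1) :=
  Ext.subsingleton_of_projective _ _ _

theorem of_subsingleton [Subsingleton M] (n : ℕ) : ExtVanishes A M n := by
  refine subsingleton_of_forall_eq 0 fun x => ?_
  have h : x = (Ext.mk₀ (𝟙 _)).comp x (zero_add n) := by simp
  have h0 : (𝟙 (ModuleCat.of A M)) = 0 := by
    ext y; exact Subsingleton.elim (α := M) _ _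
  rw [h, h0]; simp

theorem exists_extension (hf : Function.Injective f) (hg : Function.Surjective g)
    (hfg : Function.Exact f g) (hP : ExtVanishes A P 1) (φ : M →ₗ[A] A) :
    ∃ ψ : N →ₗ[A] A, ψ ∘ₗ f = φ := by
  obtain ⟨e, he⟩ := Ext.contravariant_sequence_exact₁
    (moduleShortComplex_shortExact hf hg hfg) (ModuleCat.of A A)
    (Ext.mk₀ (ModuleCat.ofHom φ)) (add_comm 1 0) (hP.elim _ _)
  obtain ⟨ψ, rfl⟩ := (Ext.mk₀_bijective _ _).2 e
  rw [Ext.mk₀_comp_mk₀] at he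
  have := (Ext.mk₀_bijective _ _).1 he
  exact ⟨ψ.hom, by rw [ModuleCat.hom_ext_iff] at this; exact this⟩

theorem one_of_extension (hf : Function.Injective f) (hg : Function.Surjective g)
    (hfg : Function.Exact f g) (hN : ExtVanishes A N 1)
    (h : ∀ φ : M →ₗ[A] A, ∃ ψ : N →ₗ[A] A, ψ ∘ₗ f = φ) : ExtVanishes A P 1 := by
  refine subsingleton_of_forall_eq 0 fun e => ?_
  obtain ⟨e', rfl⟩ := Ext.contravariant_sequence_exact₃
    (moduleShortComplex_shortExact hf hg hfg) (ModuleCat.of A A) e (hN.elim _ _) (add_comm 1 0)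
  obtain ⟨φ, rfl⟩ := (Ext.mk₀_bijective _ _).2 e'
  obtain ⟨ψ, hψ⟩ := h φ.hom
  have : φ = (moduleShortComplex hfg).f ≫ ModuleCat.ofHom ψ := by
    ext x; exact (LinearMap.congr_fun hψ x).symm
  rw [this, ← Ext.mk₀_comp_mk₀]
  exact (moduleShortComplex_shortExact hf hg hfg).extClass_comp_assoc _

theorem zero_iff : ExtVanishes A M 0 ↔ ∀ φ : M →ₗ[A] A, φ = 0 := by
  constructor
  · intro h φ
    have := (Ext.mk₀_bijective _ _).1 (h.elim (Ext.mk₀ (ModuleCat.ofHom φ)) (Ext.mk₀ 0))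
    rw [ModuleCat.hom_ext_iff] at this; exact this
  · intro h
    refine subsingleton_of_forall_eq 0 fun e => ?_
    obtain ⟨φ, rfl⟩ := (Ext.mk₀_bijective _ _).2 e
    have : φ = 0 := by ext x; exact LinearMap.congr_fun (h φ.hom) x
    rw [this, Ext.mk₀_zero]

/-- The long exact sequence of multiplication by x makes x act surjectively on the finitely
generated module Ext^n(M, A); Nakayama kills it. -/
theorem of_smul_surjective [IsNoetherianRing A] [IsLocalRing A] [Module.Finite A M]
    {x : A} (hx : x ∈ IsLocalRing.maximalIdeal A)
    (hinj : Function.Injective (LinearMap.lsmul A M x)) {n : ℕ}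
    (h : ExtVanishes A (M ⧸ LinearMap.range (LinearMap.lsmul A M x)) (n + 1)) :
    ExtVanishes A M n := by
  have hS := moduleShortComplex_shortExact hinj (Submodule.mkQ_surjective _)
    (LinearMap.exact_map_mkQ_range (LinearMap.lsmul A M x))
  have hsurj : ∀ e : Ext (ModuleCat.of A M) (ModuleCat.of A A) n, ∃ e', x • e' = e := by
    intro e
    obtain ⟨e', he'⟩ := Ext.contravariant_sequence_exact₁ hS (ModuleCat.of A A) e (add_comm 1 n)
      (h.elim _ _)
    refine ⟨e', ?_⟩
    rw [← he']
    have : (moduleShortComplex (LinearMap.exact_map_mkQ_range (LinearMap.lsmul A M x))).f =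
        x • 𝟙 (ModuleCat.of A M) := by
      ext y; rfl
    rw [this, Ext.mk₀_smul, Ext.smul_comp]
    simp
  have : (⊤ : Submodule A (Ext (ModuleCat.of A M) (ModuleCat.of A A) n)) = ⊥ := by
    refine Submodule.eq_bot_of_le_smul_of_le_jacobson_bot (IsLocalRing.maximalIdeal A) _
      Module.Finite.fg_top ?_ (IsLocalRing.maximalIdeal_le_jacobson _)
    intro e _
    obtain ⟨e', rfl⟩ := hsurj e
    exact Submodule.smul_mem_smul hx trivial
  exact (Submodule.subsingleton_iff A).1 (subsingleton_of_bot_eq_top this.symm)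

end ExtVanishes

end ExtVanishing

/-! ### From vanishing of Ext to duality of ideals -/

section Divisorial

/-- Every ideal `I` containing `y` satisfies `yA : (yA : I) = I`. -/
def IsDivisorialAt {A : Type u} [CommRing A] (y : A) : Prop :=
  ∀ I : Ideal A, y ∈ I → ∀ a, (∀ b, (∀ i ∈ I, y ∣ b * i) → y ∣ b * a) → a ∈ I

variable {A : Type u} [CommRing A]

theorem lsmul_quotient_injective {p : Ideal A} (hp : p.IsPrime) {x : A} (hxp : x ∉ p) :
    Function.Injective (LinearMap.lsmul A (A ⧸ p) x) := by
  rw [injective_iff_map_eq_zero]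
  intro y hy
  obtain ⟨y, rfl⟩ := Ideal.Quotient.mk_surjective y
  have : Ideal.Quotient.mk p (x * y) = 0 := hy
  rw [Ideal.Quotient.eq_zero_iff_mem] at this ⊢
  exact (hp.mem_or_mem this).resolve_left hxp

theorem exists_linearMap_mul_eq {x : A} (hx : x ∈ nonZeroDivisors A) (I : Ideal A) (b : A)
    (h : ∀ i ∈ I, x ∣ b * i) : ∃ φ : I →ₗ[A] A, ∀ i : I, x * φ i = b * i := by
  choose φ hφ using fun i : I => h i i.2
  refine ⟨⟨⟨φ, fun i j => ?_⟩, fun c i => ?_⟩, fun i => (hφ i).symm⟩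
  · apply (mul_cancel_left_mem_nonZeroDivisors hx).1
    rw [← hφ, mul_add, ← hφ, ← hφ]; push_cast; ring
  · apply (mul_cancel_left_mem_nonZeroDivisors hx).1
    rw [← hφ]
    simp only [smul_eq_mul, RingHom.id_apply, Submodule.coe_smul]
    rw [mul_left_comm x, ← hφ]; ring

variable (A) in
/-- `Ext^n(M, A) = 0` for all finitely generated modules `M`. -/
def ExtVanishesOnFinite (n : ℕ) : Prop :=
  ∀ (M : Type u) [AddCommGroup M] [Module A M] [Module.Finite A M], ExtVanishes A M n

theorem ExtVanishesOnFinite.of_le {k N : ℕ} (hN : ∀ n ≥ N, ExtVanishesOnFinite A n)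
    (h : ∀ n ≥ k, ExtVanishesOnFinite A (n + 1) → ExtVanishesOnFinite A n) :
    ExtVanishesOnFinite A k := by
  have (j : ℕ) : ExtVanishesOnFinite A (k + j) → ExtVanishesOnFinite A k := by
    induction j with
    | zero => exact id
    | succ j ih => exact fun hj => ih (h _ (by omega) hj)
  exact this N (hN _ (by omega))

theorem extVanishesOnFinite_of_hasInjectiveDimensionLE {n : ℕ}
    [HasInjectiveDimensionLE (ModuleCat.of A A) n] (m : ℕ) (hm : m ≥ n + 1) :
    ExtVanishesOnFinite A m :=
  fun M _ _ _ => HasInjectiveDimensionLT.subsingleton _ (n + 1) m hm (ModuleCat.of A M)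

variable [IsNoetherianRing A] [IsLocalRing A]

open IsLocalRing

/-- A prime filtration reduces to A ⧸ p. If p is not maximal, an element of the maximal ideal
outside p is regular on A ⧸ p and Nakayama applies, so only the residue field remains. -/
theorem ExtVanishesOnFinite.of_succ {n : ℕ} (h : ExtVanishesOnFinite A (n + 1))
    (hk : ExtVanishes A (A ⧸ maximalIdeal A) n) : ExtVanishesOnFinite A n := by
  intro M _ _ hM
  induction hM using IsNoetherianRing.induction_on_isQuotientEquivQuotientPrime A with
  | subsingleton N => exact .of_subsingleton n
  | exact N₁ N₂ N₃ f g hf hg hfg h₁ h₃ => exact .middle hf hg hfg h₁ h₃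
  | quotient N p e =>
    refine .of_equiv e.symm ?_
    obtain hp | hp := eq_or_ne p.1 (maximalIdeal A)
    · rwa [hp]
    obtain ⟨x, hxm, hxp⟩ : ∃ x ∈ maximalIdeal A, x ∉ p.1 := by
      by_contra! hc
      exact hp ((maximalIdeal.isMaximal A).eq_of_le p.2.ne_top hc).symm
    exact .of_smul_surjective hxm (lsmul_quotient_injective p.2 hxp) (h _)

theorem ExtVanishes.residue {n : ℕ} (h : ExtVanishesOnFinite A (n + 1))
    {N : Type u} [AddCommGroup N] [Module A N] [Module.Finite A N]
    (hN : IsAssociatedPrime (maximalIdeal A) N) (hV : ExtVanishes A N n) :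
    ExtVanishes A (A ⧸ maximalIdeal A) n := by
  obtain ⟨-, f, hf⟩ := (isAssociatedPrime_iff_exists_injective_linearMap _ _).1 hN
  exact .left hf (Submodule.mkQ_surjective _) f.exact_map_mkQ_range hV (h _)

/-- Otherwise the residue field k embeds in A. As Ext^n(A, A) = 0 for n ≥ 1, vanishing descends to
degree 1, and then Hom(A ⧸ p, A) = 0 by Nakayama. The composite A ⧸ p → k → A contradicts this. -/
theorem exists_nonZeroDivisor_of_extVanishes {N : ℕ} (hN : ∀ n ≥ N, ExtVanishesOnFinite A n)
    {p : Ideal A} (hp : p.IsPrime) (hpm : p ≠ maximalIdeal A) :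
    ∃ x ∈ maximalIdeal A, x ∈ nonZeroDivisors A := by
  by_contra! hc
  have hass : IsAssociatedPrime (maximalIdeal A) A := by
    obtain ⟨P, hP⟩ := ((maximalIdeal A).subset_union_prime_finite (associatedPrimes.finite A A)
      (f := id) 0 0 fun _ h _ _ ↦ h.isPrime).1 (by
        simp_rw [id, biUnion_associatedPrimes_eq_compl_nonZeroDivisors]
        exact hc)
    exact (maximalIdeal.isMaximal A).eq_of_le hP.1.isPrime.ne_top hP.2 ▸ hP.1
  have h1 : ExtVanishesOnFinite A 1 := .of_le hN fun n hn h => by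
    obtain ⟨n, rfl⟩ := Nat.exists_eq_add_of_le' hn
    exact h.of_succ (.residue h hass (.self_succ n))
  obtain ⟨x, hxm, hxp⟩ : ∃ x ∈ maximalIdeal A, x ∉ p := by
    by_contra! hc
    exact hpm ((maximalIdeal.isMaximal A).eq_of_le hp.ne_top hc).symm
  have h0 : ExtVanishes A (A ⧸ p) 0 :=
    .of_smul_surjective hxm (lsmul_quotient_injective hp hxp) (h1 _)
  obtain ⟨-, f, hf⟩ := (isAssociatedPrime_iff_exists_injective_linearMap _ _).1 hass
  have hzero := ExtVanishes.zero_iff.1 h0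
    (f ∘ₗ Submodule.factor (le_maximalIdeal hp.ne_top))
  have hone : f (Submodule.Quotient.mk 1) = 0 :=
    LinearMap.congr_fun hzero (Submodule.Quotient.mk 1)
  rw [map_eq_zero_iff f hf, Submodule.Quotient.mk_eq_zero] at hone
  exact (maximalIdeal.isMaximal A).ne_top ((Ideal.eq_top_iff_one _).2 hone)

theorem isAssociatedPrime_maximalIdeal {x : A}
    (hprime : ∀ p : Ideal A, p.IsPrime → x ∈ p → p = maximalIdeal A)
    (M : Type u) [AddCommGroup M] [Module A M] [Nontrivial M] (hM : ∀ y : M, x • y = 0) :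
    IsAssociatedPrime (maximalIdeal A) M := by
  obtain ⟨P, hP⟩ := associatedPrimes.nonempty A M
  have := hprime P hP.isPrime (hP.annihilator_le (by simpa [Submodule.mem_annihilator] using hM))
  exact this ▸ hP

theorem isAssociatedPrime_quotient_span {x : A} (hxm : x ∈ maximalIdeal A)
    (hprime : ∀ p : Ideal A, p.IsPrime → x ∈ p → p = maximalIdeal A) :
    IsAssociatedPrime (maximalIdeal A) (A ⧸ Ideal.span {x}) := by
  have : Nontrivial (A ⧸ Ideal.span {x}) := Ideal.Quotient.nontrivial_iff.2
    ((Ideal.span_singleton_ne_top ((mem_maximalIdeal x).1 hxm)))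
  refine isAssociatedPrime_maximalIdeal hprime _ fun y => ?_
  obtain ⟨y, rfl⟩ := Ideal.Quotient.mk_surjective y
  change Ideal.Quotient.mk _ (x * y) = 0
  rw [Ideal.Quotient.eq_zero_iff_mem]
  exact Ideal.mul_mem_right _ _ (Ideal.mem_span_singleton_self x)

/-- The residue field embeds in A ⧸ xA, whose projective dimension is at most 1, so the descent
continues down to degree 2. -/
theorem extVanishesOnFinite_two {N : ℕ} (hN : ∀ n ≥ N, ExtVanishesOnFinite A n)
    {x : A} (hx : x ∈ nonZeroDivisors A) (hxm : x ∈ maximalIdeal A)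
    (hprime : ∀ p : Ideal A, p.IsPrime → x ∈ p → p = maximalIdeal A) :
    ExtVanishesOnFinite A 2 := by
  refine .of_le hN fun n hn h => ?_
  obtain ⟨n, rfl⟩ := Nat.exists_eq_add_of_le' hn
  refine h.of_succ (.residue h (isAssociatedPrime_quotient_span hxm hprime) ?_)
  have hinj : Function.Injective (LinearMap.lsmul A A x) := fun a b hab =>
    (mul_cancel_left_mem_nonZeroDivisors hx).1 hab
  have hrange : LinearMap.range (LinearMap.lsmul A A x) = Ideal.span {x} := by
    ext a; simp [Ideal.mem_span_singleton, dvd_def, eq_comm]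
  rw [← hrange]
  exact .right hinj (Submodule.mkQ_surjective _) (LinearMap.exact_map_mkQ_range _)
    (.self_succ n) (.self_succ (n + 1))

/-- A failure at a ∉ I would force Ext^1(k, A) = 0 for the residue field k, which is impossible
because k embeds in A ⧸ xA. -/
theorem isDivisorialAt_of_extVanishes (h2 : ExtVanishesOnFinite A 2)
    {x : A} (hx : x ∈ nonZeroDivisors A) (hxm : x ∈ maximalIdeal A)
    (hprime : ∀ p : Ideal A, p.IsPrime → x ∈ p → p = maximalIdeal A) :
    IsDivisorialAt x := by
  intro I hxI a ha
  by_contra haI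
  -- some multiple `c * a` spans a copy of the residue field in `A ⧸ I`
  obtain ⟨c, hc⟩ : ∃ c, maximalIdeal A =
      LinearMap.ker (LinearMap.toSpanSingleton A (A ⧸ I) (Ideal.Quotient.mk I (c * a))) := by
    have : Nontrivial (Submodule.span A {Ideal.Quotient.mk I a}) := by
      refine Submodule.nontrivial_span_singleton ?_
      rwa [Ne, Ideal.Quotient.eq_zero_iff_mem]
    obtain ⟨-, ⟨z, hz⟩, hker⟩ := isAssociatedPrime_iff.1 (isAssociatedPrime_maximalIdeal hprime
      (Submodule.span A {Ideal.Quotient.mk I a}) (by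
        rintro ⟨y, hy⟩
        ext
        obtain ⟨y, rfl⟩ := Ideal.Quotient.mk_surjective y
        change Ideal.Quotient.mk _ (x * y) = 0
        rw [Ideal.Quotient.eq_zero_iff_mem]
        exact Ideal.mul_mem_right _ _ hxI))
    obtain ⟨c, rfl⟩ := Submodule.mem_span_singleton.1 hz
    refine ⟨c, hker.trans ?_⟩
    ext r
    simp only [Submodule.mem_colon_singleton, Submodule.mem_bot, LinearMap.mem_ker,
      LinearMap.toSpanSingleton_apply]
    rw [← Subtype.coe_inj]
    rfl
  set T := LinearMap.toSpanSingleton A (A ⧸ I) (Ideal.Quotient.mk I (c * a))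
  -- The range of T is a copy of k and equals J ⧸ I with J = I + (ca). A map I → A is multiplication
  -- by φ(x)/x, and it extends to J because a lies in the double annihilator of I.
  have hP : ExtVanishes A (LinearMap.range T) 1 := by
    let J : Ideal A := (LinearMap.range T).comap (Submodule.mkQ I)
    have hIJ : I ≤ J := fun i hi => by
      have : Submodule.mkQ I i = 0 := (Submodule.Quotient.mk_eq_zero I).2 hi
      simp [J, this]
    refine .one_of_extension (f := Submodule.inclusion hIJ)
      (g := (Submodule.mkQ I).restrict (p := J) (q := LinearMap.range T) fun _ h => h)
      (Submodule.inclusion_injective hIJ) ?_ ?_ ?_ ?_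
    · rintro ⟨z, hz⟩
      obtain ⟨w, rfl⟩ := Submodule.mkQ_surjective I z
      exact ⟨⟨w, hz⟩, rfl⟩
    · rintro ⟨z, hz⟩
      rw [← Subtype.coe_inj]
      change Submodule.mkQ I z = 0 ↔ _
      rw [Submodule.mkQ_apply, Submodule.Quotient.mk_eq_zero]
      exact ⟨fun h => ⟨⟨z, h⟩, rfl⟩, fun ⟨w, hw⟩ => by
        have : (w : A) = z := congrArg Subtype.val hw
        exact this ▸ w.2⟩
    · exact .left J.injective_subtype J.mkQ_surjective (LinearMap.exact_subtype_mkQ J)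
        (.self_succ 0) (h2 _)
    · intro φ
      have hφ (i : I) : x * φ i = φ ⟨x, hxI⟩ * i := by
        rw [← smul_eq_mul, ← map_smul, mul_comm, ← smul_eq_mul, ← map_smul]
        congr 1; ext; simp [mul_comm]
      have hdvd : ∀ j ∈ J, x ∣ φ ⟨x, hxI⟩ * j := by
        rintro j ⟨r, hr⟩
        have hj : r * (c * a) - j ∈ I := by
          rw [← Ideal.Quotient.eq]; exact hr
        have h1 := ha (φ ⟨x, hxI⟩) fun i hi => ⟨_, (hφ ⟨i, hi⟩).symm⟩
        have h3 : x ∣ φ ⟨x, hxI⟩ * (r * (c * a) - j) := ⟨_, (hφ ⟨_, hj⟩).symm⟩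
        have h4 := dvd_sub (h1.mul_right (r * c)) h3
        convert h4 using 1; ring
      obtain ⟨ψ, hψ⟩ := exists_linearMap_mul_eq hx J _ hdvd
      refine ⟨ψ, LinearMap.ext fun i => ?_⟩
      apply (mul_cancel_left_mem_nonZeroDivisors hx).1
      rw [hφ]
      exact hψ _
  -- The class of s spans a copy of k in A ⧸ xA. Multiplication by s/x on the maximal ideal extends
  -- to A since Ext^1(k, A) = 0, which forces x ∣ s.
  obtain ⟨-, s, hs⟩ := isAssociatedPrime_iff.1 (isAssociatedPrime_quotient_span hxm hprime)
  obtain ⟨s, rfl⟩ := Ideal.Quotient.mk_surjective s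
  have hmem (r : A) : r ∈ maximalIdeal A ↔ x ∣ s * r := by
    rw [hs, Submodule.mem_colon_singleton, Submodule.mem_bot, mul_comm,
      ← Ideal.mem_span_singleton, ← Ideal.Quotient.eq_zero_iff_mem]
    rfl
  obtain ⟨φ, hφ⟩ := exists_linearMap_mul_eq hx (LinearMap.ker T) s
    (fun i hi => (hmem i).1 (hc ▸ hi))
  obtain ⟨ψ, hψ⟩ := ExtVanishes.exists_extension (LinearMap.ker T).injective_subtype
    T.surjective_rangeRestrict (g := T.rangeRestrict) (by
      intro z
      rw [← Subtype.coe_inj]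
      exact ⟨fun h => ⟨⟨z, h⟩, rfl⟩, fun ⟨w, hw⟩ => hw ▸ w.2⟩) hP φ
  have hxT : x ∈ LinearMap.ker T := hc ▸ hxm
  have hsx : s = φ ⟨x, hxT⟩ := by
    apply (mul_cancel_left_mem_nonZeroDivisors hx).1
    rw [hφ, mul_comm]
  have hsψ : s = x * ψ 1 := by
    rw [hsx, ← hψ, ← smul_eq_mul, ← map_smul]; simp
  exact (maximalIdeal.isMaximal A).ne_top
    ((Ideal.eq_top_iff_one _).2 ((hmem 1).2 ⟨ψ 1, by rw [mul_one, hsψ]⟩))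

end Divisorial

/-! ### From duality of ideals to injective dimension at most 1 -/

section InjectiveDimension

variable {A : Type u} [CommRing A]

/-- If `A` is divisorial at `y`, then a map from an ideal to `A ⧸ yA` which comes from `A ⧸ yA` is
a multiplication. -/
theorem IsDivisorialAt.exists_eq_mul [IsNoetherianRing A] {y : A} (hy : IsDivisorialAt y)
    (I : Ideal A) (f : I →ₗ[A] A ⧸ Ideal.span {y}) (hf : ∀ i : I, y ∣ (i : A) → f i = 0) :
    ∃ c : A, ∀ i : I, f i = Ideal.Quotient.mk _ (c * i) := by
  have hsmul (r s : A) : r • Ideal.Quotient.mk (Ideal.span {y}) s = Ideal.Quotient.mk _ (r * s) :=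
    rfl
  have hdouble (I : Ideal A) (b : A) (hb : ∀ d, (∀ i ∈ I, y ∣ d * i) → y ∣ d * b) :
      ∃ i ∈ I, ∃ r, b = i + r * y := by
    have := hy (I ⊔ Ideal.span {y})
      (Ideal.mem_sup_right (Ideal.mem_span_singleton_self y)) b fun d hd =>
      hb d fun i hi => hd i (Ideal.mem_sup_left hi)
    obtain ⟨i, hi, z, hz, rfl⟩ := Submodule.mem_sup.1 this
    obtain ⟨r, rfl⟩ := Ideal.mem_span_singleton'.1 hz
    exact ⟨i, hi, r, rfl⟩
  induction I, IsNoetherian.noetherian I using Submodule.fg_induction with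
  | singleton a =>
    obtain ⟨b, hb⟩ := Ideal.Quotient.mk_surjective (f ⟨a, Submodule.mem_span_singleton_self a⟩)
    -- Whatever kills a modulo y also kills its image b, so duality puts b in aA + yA.
    obtain ⟨i, hi, r, hr⟩ := hdouble (Ideal.span {a}) b fun d hd => by
      have h1 := hd a (Ideal.mem_span_singleton_self a)
      have h2 := hf (d • ⟨a, Submodule.mem_span_singleton_self a⟩) h1
      rw [map_smul, ← hb, hsmul, Ideal.Quotient.eq_zero_iff_mem,
        Ideal.mem_span_singleton] at h2
      exact h2
    obtain ⟨c, rfl⟩ := Ideal.mem_span_singleton'.1 hi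
    refine ⟨c, ?_⟩
    rintro ⟨z, hz⟩
    obtain ⟨e, rfl⟩ := Submodule.mem_span_singleton.1 hz
    have : (⟨e • a, hz⟩ : Submodule.span A {a}) =
      e • ⟨a, Submodule.mem_span_singleton_self a⟩ := rfl
    rw [this, map_smul, ← hb, hsmul, Ideal.Quotient.eq, Ideal.mem_span_singleton, hr]
    exact ⟨e * r, by simp; ring⟩
  | sup I₁ I₂ _ _ h₁ h₂ =>
    obtain ⟨c₁, hc₁⟩ := h₁ (f ∘ₗ Submodule.inclusion le_sup_left) fun i hi => hf _ hi
    obtain ⟨c₂, hc₂⟩ := h₂ (f ∘ₗ Submodule.inclusion le_sup_right) fun i hi => hf _ hi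
    let D (I : Ideal A) : Ideal A := (Ideal.span {y} : Ideal A).colon I
    have hD (I : Ideal A) (d : A) : d ∈ D I ↔ ∀ i ∈ I, y ∣ d * i := by
      simp [D, Submodule.mem_colon, Ideal.mem_span_singleton]
    have hyD (I : Ideal A) : y ∈ D I := (hD I y).2 fun i _ => Dvd.intro _ rfl
    -- The two multipliers agree modulo y on overlaps of I₁ and I₂; duality splits their difference
    -- as d₁ + d₂, and c₁ - d₁ = c₂ + d₂ then works on both ideals.
    have hmem : c₁ - c₂ ∈ D I₁ ⊔ D I₂ := by
      refine hy _ (Ideal.mem_sup_left (hyD _)) _ fun b hb => ?_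
      obtain ⟨i, hi, r, hr⟩ := hdouble I₁ b fun d hd => by
        rw [mul_comm]; exact hb d (Ideal.mem_sup_left ((hD _ _).2 hd))
      obtain ⟨j, hj, s, hs⟩ := hdouble I₂ b fun d hd => by
        rw [mul_comm]; exact hb d (Ideal.mem_sup_right ((hD _ _).2 hd))
      have hij : f (Submodule.inclusion le_sup_left ⟨i, hi⟩) =
          f (Submodule.inclusion le_sup_right ⟨j, hj⟩) := by
        rw [← sub_eq_zero, ← map_sub]
        refine hf _ ⟨s - r, ?_⟩
        have : i - j = y * (s - r) := by linear_combination hs - hr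
        simpa using this
      have h1 := hc₁ ⟨i, hi⟩
      have h2 := hc₂ ⟨j, hj⟩
      rw [LinearMap.comp_apply] at h1 h2
      rw [h1, h2, Ideal.Quotient.eq, Ideal.mem_span_singleton] at hij
      obtain ⟨t, ht⟩ := hij
      refine ⟨t + c₁ * r - c₂ * s, ?_⟩
      simp only at ht
      linear_combination ht + c₁ * hr - c₂ * hs
    obtain ⟨d₁, hd₁, d₂, hd₂, hd⟩ := Submodule.mem_sup.1 hmem
    rw [hD] at hd₁ hd₂
    refine ⟨c₁ - d₁, ?_⟩
    rintro ⟨z, hz⟩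
    obtain ⟨i, hi, j, hj, rfl⟩ := Submodule.mem_sup.1 hz
    have : (⟨i + j, hz⟩ : (I₁ ⊔ I₂ : Ideal A)) =
      Submodule.inclusion le_sup_left ⟨i, hi⟩ + Submodule.inclusion le_sup_right ⟨j, hj⟩ := rfl
    have h1 := hc₁ ⟨i, hi⟩
    have h2 := hc₂ ⟨j, hj⟩
    rw [LinearMap.comp_apply] at h1 h2
    rw [this, map_add, h1, h2, ← map_add, Ideal.Quotient.eq, Ideal.mem_span_singleton]
    have h3 := dvd_sub (hd₁ i hi) (hd₂ j hj)
    change y ∣ c₁ * i + c₂ * j - (c₁ - d₁) * (i + j)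
    convert h3 using 1
    linear_combination j * hd

/-- An element form of the Artin-Rees lemma for a principal ideal. -/
theorem exists_pow_dvd_imp_eq_pow_mul [IsNoetherianRing A] (x : A) (I : Ideal A) :
    ∃ k : ℕ, ∀ n, ∀ i ∈ I, x ^ (n + k) ∣ i → ∃ j ∈ I, i = x ^ n * j := by
  obtain ⟨k, hk⟩ := (Ideal.span {x}).exists_pow_inf_eq_pow_smul (M := A) I
  refine ⟨k, fun n i hi hdvd => ?_⟩
  have h1 : i ∈ (Ideal.span {x}) ^ (n + k) • (⊤ : Ideal A) ⊓ I := by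
    refine ⟨?_, hi⟩
    rw [Ideal.span_singleton_pow, smul_eq_mul, Ideal.mul_top]
    exact Ideal.mem_span_singleton.2 hdvd
  rw [hk (n + k) (by omega), Nat.add_sub_cancel, Ideal.span_singleton_pow, smul_eq_mul,
    Ideal.mem_span_singleton_mul] at h1
  obtain ⟨j, hj, rfl⟩ := h1
  exact ⟨j, hj.2, rfl⟩

variable [IsNoetherianRing A] {x : A} (K : Type u) [CommRing K] [Algebra A K]
  [IsLocalization.Away x K]

theorem exists_pow_smul_linearMap (I : Ideal A) (hx : x ∈ nonZeroDivisors A) (f : I →ₗ[A] K) :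
    ∃ (n : ℕ) (h : I →ₗ[A] A), ∀ i, algebraMap A K (x ^ n) * f i = algebraMap A K (h i) := by
  have hinj : Function.Injective (algebraMap A K) :=
    IsLocalization.injective K (Submonoid.powers_le.2 hx)
  have : ∃ n : ℕ, ∀ i, ∃ a, algebraMap A K (x ^ n) * f i = algebraMap A K a := by
    have hfg : (LinearMap.range f).FG := Module.Finite.iff_fg.1 inferInstance
    obtain ⟨s, hs⟩ := hfg
    obtain ⟨⟨_, n, rfl⟩, hn⟩ := IsLocalization.exist_integer_multiples_of_finset
      (Submonoid.powers x) s
    refine ⟨n, fun i => ?_⟩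
    have hle : LinearMap.range f ≤ (LinearMap.range (Algebra.linearMap A K)).comap
        (LinearMap.lsmul A K (x ^ n)) := by
      rw [← hs, Submodule.span_le]
      intro z hz
      obtain ⟨a, ha⟩ := hn z hz
      exact ⟨a, ha⟩
    obtain ⟨a, ha⟩ := hle (LinearMap.mem_range_self f i)
    refine ⟨a, ?_⟩
    rw [← Algebra.smul_def]; exact ha.symm
  obtain ⟨n, hn⟩ := this
  choose h hh using hn
  refine ⟨n, ⟨⟨h, fun i j => hinj ?_⟩, fun c i => hinj ?_⟩, hh⟩
  · rw [map_add, ← hh, ← hh, ← hh, map_add, mul_add]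
  · simp only [RingHom.id_apply, smul_eq_mul]
    rw [map_mul, ← hh, ← hh, map_smul, Algebra.smul_def]; ring

/-- After clearing denominators, x^k h is multiplication by a constant modulo each x^(n+k), with k
from Artin-Rees. Krull's intersection theorem in Hom(I, A) modulo the multiplications makes it one
exactly. -/
theorem IsDivisorialAt.baer_away (hx : x ∈ nonZeroDivisors A)
    (hxJ : x ∈ Ideal.jacobson (⊥ : Ideal A)) (hdiv : ∀ n, IsDivisorialAt (x ^ n)) :
    Module.Baer A K := by
  intro I f
  obtain ⟨m, h, hfh⟩ := exists_pow_smul_linearMap K I hx f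
  obtain ⟨k, hk⟩ := exists_pow_dvd_imp_eq_pow_mul x I
  have hmem : (Submodule.span A {(I.subtype : I →ₗ[A] A)}).mkQ (x ^ k • h) = 0 := by
    have hbot := Ideal.iInf_pow_smul_eq_bot_of_le_jacobson
      (M := (I →ₗ[A] A) ⧸ Submodule.span A {(I.subtype : I →ₗ[A] A)}) (Ideal.span {x})
      ((Ideal.span_singleton_le_iff_mem _).2 hxJ)
    rw [← Submodule.mem_bot A, ← hbot, Submodule.mem_iInf]
    intro n
    obtain ⟨c, hc⟩ := (hdiv (n + k)).exists_eq_mul I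
      (Submodule.mkQ (Ideal.span {x ^ (n + k)}) ∘ₗ (x ^ k • h)) fun i hi => by
        obtain ⟨j, hj, hij⟩ := hk n i i.2 hi
        have : i = x ^ n • (⟨j, hj⟩ : I) := Subtype.ext hij
        rw [LinearMap.comp_apply, Submodule.mkQ_apply, Submodule.Quotient.mk_eq_zero,
          Ideal.mem_span_singleton, this, LinearMap.smul_apply, map_smul]
        exact ⟨h ⟨j, hj⟩, by simp only [smul_eq_mul]; ring⟩
    have hdvd (i : I) : ∃ a, x ^ k * h i - c * i = x ^ (n + k) * a := by
      have := hc i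
      rw [LinearMap.comp_apply] at this
      exact Ideal.mem_span_singleton.1 (Ideal.Quotient.eq.1 this)
    choose g hg using hdvd
    have hreg : x ^ (n + k) ∈ nonZeroDivisors A := pow_mem hx _
    let g' : I →ₗ[A] A :=
      { toFun := g
        map_add' := fun i j => by
          apply (mul_cancel_left_mem_nonZeroDivisors hreg).1
          rw [mul_add, ← hg, ← hg, ← hg, map_add]; push_cast; ring
        map_smul' := fun r i => by
          apply (mul_cancel_left_mem_nonZeroDivisors hreg).1
          simp only [RingHom.id_apply, smul_eq_mul]
          rw [mul_left_comm, ← hg, ← hg, map_smul]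
          simp only [Submodule.coe_smul, smul_eq_mul]
          ring }
    have heq : x ^ k • h = c • (I.subtype : I →ₗ[A] A) + x ^ n • (x ^ k • g') := by
      ext i
      simp only [LinearMap.add_apply, LinearMap.smul_apply, smul_eq_mul, Submodule.subtype_apply]
      change _ = _ + _ * (_ * g i)
      linear_combination hg i
    rw [heq, map_add, map_smul, (LinearMap.mem_ker (f := Submodule.mkQ _)).1
      (by rw [Submodule.ker_mkQ]; exact Submodule.mem_span_singleton_self _), smul_zero, zero_add,
      map_smul]
    exact Submodule.smul_mem_smul (Ideal.pow_mem_pow (Ideal.mem_span_singleton_self x) n) trivial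
  rw [Submodule.mkQ_apply, Submodule.Quotient.mk_eq_zero, Submodule.mem_span_singleton] at hmem
  obtain ⟨c, hc⟩ := hmem
  obtain ⟨u, hu⟩ := (IsLocalization.Away.algebraMap_isUnit (S := K) x).pow (k + m)
  refine ⟨LinearMap.toSpanSingleton A K (u⁻¹ * algebraMap A K c), fun i hi => ?_⟩
  have h1 := hfh ⟨i, hi⟩
  have h2 : c * i = x ^ k * h ⟨i, hi⟩ := LinearMap.congr_fun hc ⟨i, hi⟩
  apply (Units.isUnit u).mul_left_cancel
  rw [LinearMap.toSpanSingleton_apply, Algebra.smul_def, mul_left_comm, Units.mul_inv_cancel_left,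
    hu, mul_comm, ← map_mul, h2, map_mul, ← h1]
  simp only [map_pow]
  ring

/-- A map g from a finitely generated ideal is killed by some x^n, so it lands in x^(-(n+k))A ⧸ A ≅
A ⧸ x^(n+k)A; by Artin-Rees it vanishes on multiples of x^(n+k), so it is a multiplication. -/
theorem IsDivisorialAt.baer_away_quotient (hx : x ∈ nonZeroDivisors A)
    (hdiv : ∀ n, IsDivisorialAt (x ^ n)) :
    Module.Baer A (K ⧸ LinearMap.range (Algebra.linearMap A K)) := by
  intro I g
  have hinj : Function.Injective (algebraMap A K) :=
    IsLocalization.injective K (Submonoid.powers_le.2 hx)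
  obtain ⟨n, hn⟩ : ∃ n : ℕ, ∀ i, x ^ n • g i = 0 := by
    have htors (z : K ⧸ LinearMap.range (Algebra.linearMap A K)) : ∃ n : ℕ, x ^ n • z = 0 := by
      obtain ⟨z, rfl⟩ := Submodule.mkQ_surjective _ z
      obtain ⟨⟨_, n, rfl⟩, a, ha⟩ := IsLocalization.exists_integer_multiple (Submonoid.powers x) z
      exact ⟨n, by rw [← map_smul]; exact (Submodule.Quotient.mk_eq_zero _).2 ⟨a, ha⟩⟩
    choose e he using htors
    obtain ⟨s, hs⟩ : (LinearMap.range g).FG := Module.Finite.iff_fg.1 inferInstance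
    refine ⟨s.sup e, fun i => ?_⟩
    have hle : LinearMap.range g ≤ LinearMap.ker (LinearMap.lsmul A _ (x ^ s.sup e)) := by
      rw [← hs, Submodule.span_le]
      intro z hz
      obtain ⟨d, hd⟩ := Nat.exists_eq_add_of_le' (Finset.le_sup (f := e) hz)
      change x ^ s.sup e • z = 0
      rw [hd, pow_add, mul_smul, he, smul_zero]
    exact hle (LinearMap.mem_range_self g i)
  obtain ⟨k, hk⟩ := exists_pow_dvd_imp_eq_pow_mul x I
  obtain ⟨u, hu⟩ := (IsLocalization.Away.algebraMap_isUnit (S := K) x).pow (n + k)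
  let π := Submodule.mkQ (LinearMap.range (Algebra.linearMap A K))
  have hπ (z : K) : π z = 0 ↔ ∃ a, algebraMap A K a = z := by
    rw [Submodule.mkQ_apply, Submodule.Quotient.mk_eq_zero]; rfl
  have hex (i : I) : ∃ a : A, π (u⁻¹ * algebraMap A K a) = g i := by
    obtain ⟨z, hz⟩ := Submodule.mkQ_surjective _ (g i)
    have h0 : π (x ^ (n + k) • z) = 0 := by
      rw [map_smul]
      change _ • Submodule.mkQ _ z = 0
      rw [hz, add_comm, pow_add, mul_smul, hn, smul_zero]
    obtain ⟨a, ha⟩ := (hπ _).1 h0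
    refine ⟨a, ?_⟩
    rw [ha, Algebra.smul_def, map_pow, ← hu, Units.inv_mul_cancel_left]
    exact hz
  have hzero (a : A) : π (u⁻¹ * algebraMap A K a) = 0 ↔ x ^ (n + k) ∣ a := by
    rw [hπ]
    refine exists_congr fun b => ?_
    rw [Units.eq_inv_mul_iff_mul_eq, hu, ← map_pow, ← map_mul, hinj.eq_iff, eq_comm]
  choose f hf using hex
  let mk := Ideal.Quotient.mk (Ideal.span {x ^ (n + k)})
  have hmk (a b : A) : mk a = mk b ↔ π (u⁻¹ * algebraMap A K a) = π (u⁻¹ * algebraMap A K b) := by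
    rw [Ideal.Quotient.eq, Ideal.mem_span_singleton, ← hzero, map_sub, mul_sub, map_sub, sub_eq_zero]
  let f' : I →ₗ[A] A ⧸ Ideal.span {x ^ (n + k)} :=
    { toFun := fun i => mk (f i)
      map_add' := fun i j => by
        rw [← map_add, hmk, map_add, mul_add, map_add, hf, hf, hf, map_add]
      map_smul' := fun r i => by
        change _ = mk (r * f i)
        rw [hmk, hf, map_mul (algebraMap A K), mul_left_comm, ← Algebra.smul_def, map_smul, map_smul, hf] }
  obtain ⟨c, hc⟩ := (hdiv (n + k)).exists_eq_mul I f' fun i hi => by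
    obtain ⟨j, hj, hij⟩ := hk n i i.2 hi
    have : i = x ^ n • (⟨j, hj⟩ : I) := Subtype.ext hij
    change mk (f i) = 0
    rw [← map_zero mk, hmk, hf, this, map_smul, hn]
    simp
  refine ⟨π ∘ₗ LinearMap.toSpanSingleton A K (u⁻¹ * algebraMap A K c), fun i hi => ?_⟩
  have h1 := (hmk _ _).1 (hc ⟨i, hi⟩)
  rw [hf] at h1
  rw [h1, LinearMap.comp_apply, LinearMap.toSpanSingleton_apply, Algebra.smul_def,
    map_mul (algebraMap A K)]
  congr 1; ring

theorem IsDivisorialAt.hasInjectiveDimensionLE (hx : x ∈ nonZeroDivisors A)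
    (hxJ : x ∈ Ideal.jacobson (⊥ : Ideal A)) (hdiv : ∀ n, IsDivisorialAt (x ^ n)) :
    HasInjectiveDimensionLE (ModuleCat.of A A) 1 := by
  let K := Localization.Away x
  have hinj : Function.Injective (Algebra.linearMap A K) :=
    IsLocalization.injective K (Submonoid.powers_le.2 hx)
  have h₂ := (IsDivisorialAt.baer_away K hx hxJ hdiv).injective
  have h₃ := (IsDivisorialAt.baer_away_quotient K hx hdiv).injective
  have := Module.injective_object_of_injective_module A K
  have := Module.injective_object_of_injective_module A
    (K ⧸ LinearMap.range (Algebra.linearMap A K))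
  have hS := moduleShortComplex_shortExact hinj (Submodule.mkQ_surjective _)
    (LinearMap.exact_map_mkQ_range (Algebra.linearMap A K))
  exact hS.hasInjectiveDimensionLT_X₁ 1 (inferInstanceAs (HasInjectiveDimensionLT (ModuleCat.of A
    (K ⧸ LinearMap.range (Algebra.linearMap A K))) 1))
    (inferInstanceAs (HasInjectiveDimensionLT (ModuleCat.of A K) (1 + 1)))

end InjectiveDimension

/-! ### Duality for Gorenstein rings, and localization -/

section Gorenstein

open IsLocalRing

variable {A : Type u} [CommRing A]

theorem IsDivisorialAt.of_isUnit {y : A} (hy : IsUnit y) : IsDivisorialAt y :=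
  fun I hyI _ _ => I.eq_top_of_isUnit_mem hyI hy ▸ Submodule.mem_top

theorem IsGorensteinLocalRing.isDivisorialAt (hA : IsGorensteinLocalRing A) {y : A}
    (hy : y ∈ nonZeroDivisors A) (hprime : ∀ p : Ideal A, p.IsPrime → y ∈ p → p.IsMaximal) :
    IsDivisorialAt y := by
  obtain ⟨_, _, n, _⟩ := hA
  by_cases hym : y ∈ maximalIdeal A
  · have hprime' (p : Ideal A) (hp : p.IsPrime) (hyp : y ∈ p) : p = maximalIdeal A :=
      eq_maximalIdeal (hprime p hp hyp)
    exact isDivisorialAt_of_extVanishes (extVanishesOnFinite_two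
      (extVanishesOnFinite_of_hasInjectiveDimensionLE (n := n)) hy hym hprime') hy hym hprime'
  · exact .of_isUnit (by simpa using hym)

theorem Ideal.isMaximal_of_mem_nonZeroDivisors [Ring.KrullDimLE 1 A] {y : A}
    (hy : y ∈ nonZeroDivisors A) (p : Ideal A) (hp : p.IsPrime) (hyp : y ∈ p) : p.IsMaximal :=
  (Ring.krullDimLE_one_iff.1 ‹_› p hp).resolve_left fun h =>
    Set.disjoint_left.1 (Ideal.disjoint_nonZeroDivisors_of_mem_minimalPrimes h) hyp hy

theorem IsGorensteinLocalRing.exists_nonZeroDivisor (hA : IsGorensteinLocalRing A)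
    (hdim : ringKrullDim A = 1) :
    ∃ x ∈ nonZeroDivisors A, ∀ m : Ideal A, m.IsMaximal → x ∈ m := by
  obtain ⟨_, _, n, _⟩ := hA
  obtain ⟨p, hp, hpm⟩ : ∃ p : Ideal A, p.IsPrime ∧ ¬ p.IsMaximal := by
    by_contra! hc
    have := Ring.krullDimLE_iff.1 (Ring.krullDimLE_zero_iff.2 hc)
    rw [hdim] at this
    exact absurd this (by decide)
  obtain ⟨x, hxm, hx⟩ := exists_nonZeroDivisor_of_extVanishes
    (extVanishesOnFinite_of_hasInjectiveDimensionLE (n := n)) hp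
    (fun h => hpm (h ▸ maximalIdeal.isMaximal A))
  exact ⟨x, hx, fun m hm => eq_maximalIdeal hm ▸ hxm⟩

theorem isDivisorialAt_of_localization [IsNoetherianRing A] {y : A}
    (h : ∀ (m : Ideal A) [m.IsMaximal],
      IsDivisorialAt (algebraMap A (Localization.AtPrime m) y)) :
    IsDivisorialAt y := by
  intro I hyI a ha
  by_contra haI
  obtain ⟨m, hm, hle⟩ := Ideal.exists_le_maximal ((I : Ideal A).colon {a}) (by
    rw [Ne, Ideal.eq_top_iff_one, Submodule.mem_colon_singleton, one_smul]; exact haI)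
  have hmem : algebraMap A (Localization.AtPrime m) a ∈
      I.map (algebraMap A (Localization.AtPrime m)) := by
    refine h m _ (Ideal.mem_map_of_mem _ hyI) _ fun b' hb' => ?_
    obtain ⟨b, s, rfl⟩ := IsLocalization.exists_mk'_eq m.primeCompl b'
    have hdvd (i : A) (hi : i ∈ I) : ∃ t ∈ m.primeCompl, y ∣ t * (b * i) := by
      have h1 := hb' _ (Ideal.mem_map_of_mem _ hi)
      have h2 : algebraMap A (Localization.AtPrime m) (b * i) ∈
          (Ideal.span {y}).map (algebraMap A (Localization.AtPrime m)) := by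
        rw [Ideal.map_span, Set.image_singleton, Ideal.mem_span_singleton, map_mul,
          ← IsLocalization.mk'_spec _ b s]
        exact (h1.mul_left (algebraMap A _ s)).trans (dvd_of_eq (by ring))
      obtain ⟨t, ht, h3⟩ := (IsLocalization.algebraMap_mem_map_algebraMap_iff m.primeCompl
        _ _ _).1 h2
      exact ⟨t, ht, Ideal.mem_span_singleton.1 h3⟩
    obtain ⟨t, ht, htI⟩ : ∃ t ∈ m.primeCompl, ∀ i ∈ I, y ∣ t * (b * i) := by
      obtain ⟨g, hg⟩ := IsNoetherian.noetherian I
      have hgI : ∀ i ∈ g, i ∈ I := fun i hi => hg ▸ Submodule.subset_span hi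
      choose! t ht1 ht2 using hdvd
      -- One denominator serves all of I because I is finitely generated.
      refine ⟨∏ i ∈ g, t i, prod_mem fun i hi => ht1 i (hgI i hi), ?_⟩
      have : I ≤ Submodule.comap
          (LinearMap.mulLeft A ((∏ i ∈ g, t i) * b)) (Ideal.span {y}) := by
        conv_lhs => rw [← hg]
        rw [Submodule.span_le]
        intro i hi
        change (∏ i ∈ g, t i) * b * i ∈ Ideal.span {y}
        rw [Ideal.mem_span_singleton, mul_assoc]
        exact (ht2 i (hgI i hi)).trans (mul_dvd_mul_right (Finset.dvd_prod_of_mem t hi) _)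
      intro i hi
      rw [← mul_assoc]
      exact Ideal.mem_span_singleton.1 (this hi)
    have h4 := ha (t * b) fun i hi => by rw [mul_assoc]; exact htI i hi
    have h5 := map_dvd (algebraMap A (Localization.AtPrime m)) h4
    rw [map_mul, map_mul, ← IsLocalization.mk'_spec _ b s] at h5
    have hut := IsLocalization.map_units (Localization.AtPrime m) (⟨t, ht⟩ : m.primeCompl)
    have hus := IsLocalization.map_units (Localization.AtPrime m) s
    rw [mul_comm (IsLocalization.mk' _ b s), mul_assoc, mul_assoc] at h5
    exact hus.dvd_mul_left.1 (hut.dvd_mul_left.1 h5)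
  obtain ⟨t, ht, h3⟩ := (IsLocalization.algebraMap_mem_map_algebraMap_iff m.primeCompl _ _ _).1 hmem
  exact ht (hle (by simpa [Submodule.mem_colon_singleton] using h3))

theorem IsGorensteinRing.isDivisorialAt (hA : IsGorensteinRing A) {y : A}
    (hy : y ∈ nonZeroDivisors A) (hprime : ∀ p : Ideal A, p.IsPrime → y ∈ p → p.IsMaximal) :
    IsDivisorialAt y := by
  have := hA.isNoetherianRing
  refine isDivisorialAt_of_localization fun m _ => (hA.localization m).isDivisorialAt
    (IsLocalization.map_nonZeroDivisors_le m.primeCompl _ (Submonoid.mem_map_of_mem _ hy))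
    fun p hp hyp => ?_
  -- The contraction of p contains y, so it is maximal and must be m itself.
  have hcomap : (p.comap (algebraMap A (Localization.AtPrime m))).IsMaximal :=
    hprime _ (hp.comap _) hyp
  have hle : p.comap (algebraMap A (Localization.AtPrime m)) ≤ m := 
    (Ideal.comap_mono (le_maximalIdeal hp.ne_top)).trans_eq
      (IsLocalization.AtPrime.under_maximalIdeal (Localization.AtPrime m) m)
  have heq := hcomap.eq_of_le (Ideal.IsPrime.ne_top inferInstance) hle
  have : p = maximalIdeal (Localization.AtPrime m) := by
    rw [← IsLocalization.map_under m.primeCompl (Localization.AtPrime m) p, Ideal.under_def, heq,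
      Localization.AtPrime.map_eq_maximalIdeal]
  exact this ▸ maximalIdeal.isMaximal _

theorem isGorensteinRing_of_hasInjectiveDimensionLE [IsNoetherianRing A] {n : ℕ}
    [HasInjectiveDimensionLE (ModuleCat.of A A) n] : IsGorensteinRing A where
  isNoetherianRing := inferInstance
  localization m _ := by
    refine ⟨inferInstance, IsLocalization.isNoetherianRing m.primeCompl _ inferInstance, n, ?_⟩
    have key (M : ModuleCat.{u} A) (g : M →ₗ[A] Localization.AtPrime m)
        (_ : IsLocalizedModule m.primeCompl g) (_ : HasInjectiveDimensionLE M n) :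
        HasInjectiveDimensionLE
          (ModuleCat.of (Localization.AtPrime m) (Localization.AtPrime m)) n :=
      (ModuleCat.hasInjectiveDimensionLE_iff_of_linearEquiv
        ((IsLocalizedModule.linearEquiv m.primeCompl (M.localizedModuleMkLinearMap m.primeCompl)
          g).extendScalarsOfIsLocalization m.primeCompl (Localization.AtPrime m)) n).1
        (ModuleCat.localizedModule_hasInjectiveDimensionLE n m.primeCompl M)
    exact key (ModuleCat.of A A) (Algebra.linearMap A (Localization.AtPrime m))
      (inferInstanceAs (IsLocalizedModule m.primeCompl
        (Algebra.linearMap A (Localization.AtPrime m)))) inferInstance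

end Gorenstein

/-! ### Duality and homomorphisms of fractional ideals -/

section FractionRing

variable {A : Type u} [CommRing A] {Q : Type v} [CommRing Q] [Algebra A Q] [IsFractionRing A Q]

/-- Regular fractional ideals of a ring that is divisorial at all its non-zero-divisors are
divisorial. -/
theorem one_div_one_div_le (hA : ∀ y ∈ nonZeroDivisors A, IsDivisorialAt y)
    (F : Submodule A Q) {d : A} (hd : d ∈ nonZeroDivisors A)
    (hdF : ∀ f ∈ F, ∃ a, algebraMap A Q a = algebraMap A Q d * f)
    {y : A} (hy : y ∈ nonZeroDivisors A) (hyF : algebraMap A Q y ∈ F) :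
    (1 : Submodule A Q) / (1 / F) ≤ F := by
  intro q hq
  rw [Submodule.mem_div_iff_forall_mul_mem] at hq
  have hinj := IsFractionRing.injective A Q
  obtain ⟨u, hu⟩ := IsLocalization.map_units Q (⟨d, hd⟩ : nonZeroDivisors A)
  obtain ⟨w, hw⟩ := IsLocalization.map_units Q (⟨y, hy⟩ : nonZeroDivisors A)
  dsimp only at hu hw
  obtain ⟨a, ha⟩ := Submodule.mem_one.1 (hq (algebraMap A Q d) (by
    rw [Submodule.mem_div_iff_forall_mul_mem]
    intro f hf
    obtain ⟨a, ha⟩ := hdF f hf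
    exact Submodule.mem_one.2 ⟨a, ha⟩))
  -- Here u = d, so I is the integral ideal dF; it contains dy, and a = dq. If b multiplies I into
  -- dyA, then b/y lies in the dual of F.
  let I : Ideal A := F.comap (LinearMap.toSpanSingleton A Q ↑u⁻¹)
  have hI (z : A) : z ∈ I ↔ algebraMap A Q z * ↑u⁻¹ ∈ F := by
    rw [← Algebra.smul_def]; rfl
  have haI : a ∈ I := by
    refine hA (d * y) (mul_mem hd hy) I ?_ a fun b hb => ?_
    · rw [hI, map_mul, ← hu, mul_comm, Units.inv_mul_cancel_left]; exact hyF
    · obtain ⟨e, he⟩ := Submodule.mem_one.1 (hq (algebraMap A Q b * ↑w⁻¹) (by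
        rw [Submodule.mem_div_iff_forall_mul_mem]
        intro f hf
        obtain ⟨i, hi⟩ := hdF f hf
        obtain ⟨e, he⟩ := hb i (by
          rw [hI, hi, ← hu, mul_comm, Units.inv_mul_cancel_left]; exact hf)
        refine Submodule.mem_one.2 ⟨e, ?_⟩
        apply (u * w).isUnit.mul_left_cancel
        have := congrArg (algebraMap A Q) he
        simp only [map_mul, hi, ← hu, ← hw] at this
        push_cast
        linear_combination -this - u * algebraMap A Q b * f * w.mul_inv))
      refine ⟨e, hinj ?_⟩
      simp only [map_mul, ha, he, ← hu, ← hw]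
      linear_combination -(u : Q) * algebraMap A Q b * q * w.mul_inv
  rw [hI, ha, ← hu, Units.mul_inv_cancel_right] at haI
  exact haI

/-- Linear maps between submodules of the total ring of fractions are multiplications, as soon as
the source contains a non-zero-divisor. -/
noncomputable def divEquivLinearMap (F G : Submodule A Q) {y : A} (hy : y ∈ nonZeroDivisors A)
    (hyF : algebraMap A Q y ∈ F) : (G / F : Submodule A Q) ≃ₗ[A] (F →ₗ[A] G) :=
  LinearEquiv.ofBijective (M := (G / F : Submodule A Q)) (M₂ := F →ₗ[A] G)
    { toFun := fun q => (LinearMap.mulLeft A (q : Q)).restrict fun f hf =>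
        Submodule.mem_div_iff_forall_mul_mem.1 q.2 f hf
      map_add' := fun p q => by ext f; exact add_mul _ _ _
      map_smul' := fun r q => by ext f; exact smul_mul_assoc _ _ _ }
    (by
      obtain ⟨w, hw⟩ := IsLocalization.map_units Q (⟨y, hy⟩ : nonZeroDivisors A)
      dsimp only at hw
      constructor
      · intro p q hpq
        have : (p : Q) * algebraMap A Q y = q * algebraMap A Q y :=
          congrArg Subtype.val (LinearMap.congr_fun hpq ⟨_, hyF⟩)
        rw [← hw] at this
        exact Subtype.ext (w.isUnit.mul_right_cancel this)
      · intro φ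
        -- Writing f = a/s, linearity of φ on (ys)f = ay gives φ(f) = (φ(y)/y)f.
        have key (f : F) : ↑w⁻¹ * (φ ⟨_, hyF⟩ : Q) * f = φ f := by
          obtain ⟨⟨a, s⟩, hs⟩ := IsLocalization.surj (nonZeroDivisors A) (f : Q)
          dsimp only at hs
          have h1 : (y * s : A) • f = a • (⟨_, hyF⟩ : F) := by
            ext
            simp only [Submodule.coe_smul, Algebra.smul_def, map_mul]
            linear_combination algebraMap A Q y * hs
          have h2 := congrArg (fun z : F => (φ z : Q)) h1
          simp only [map_smul, Submodule.coe_smul, Algebra.smul_def, map_mul] at h2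
          apply (w.isUnit.mul (IsLocalization.map_units Q s)).mul_left_cancel
          linear_combination (φ ⟨_, hyF⟩ : Q) * hs - h2 -
            algebraMap A Q s * (φ f : Q) * hw + (algebraMap A Q s * (φ ⟨_, hyF⟩ : Q) * f) * w.mul_inv
        refine ⟨⟨↑w⁻¹ * (φ ⟨_, hyF⟩ : Q), ?_⟩, ?_⟩
        · rw [Submodule.mem_div_iff_forall_mul_mem]
          intro f hf
          rw [key ⟨f, hf⟩]
          exact (φ ⟨f, hf⟩).2
        · ext f
          exact key f)

/-- The total ring of fractions of `A` is also that of every intermediate ring. -/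
theorem Subalgebra.isFractionRing (S : Subalgebra A Q) : IsFractionRing S Q := by
  refine ⟨fun s => ?_, fun z => ?_, fun {a b} h => ⟨1, ?_⟩⟩
  · obtain ⟨⟨a, r⟩, hr⟩ := IsLocalization.surj (nonZeroDivisors A) (s.1 : Q)
    dsimp only at hr
    have ha : a ∈ nonZeroDivisors A := by
      rw [mem_nonZeroDivisors_iff_right]
      intro b hb
      have h1 : (algebraMap A S (r * b)) * s.1 = 0 := by
        apply Subtype.ext
        change algebraMap A Q (r * b) * (s.1 : Q) = 0
        rw [map_mul, mul_right_comm, mul_comm (algebraMap A Q r), hr, ← map_mul, mul_comm, hb,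
          map_zero]
      have h2 : algebraMap A Q (r * b) = 0 :=
        congrArg Subtype.val (mem_nonZeroDivisors_iff_right.1 s.2 _ h1)
      rw [map_eq_zero_iff _ (IsFractionRing.injective A Q), mul_comm] at h2
      exact mem_nonZeroDivisors_iff_right.1 r.2 _ h2
    have := IsLocalization.map_units Q (⟨a, ha⟩ : nonZeroDivisors A)
    dsimp only at this
    rw [← hr] at this
    exact isUnit_of_mul_isUnit_left this
  · obtain ⟨⟨a, r⟩, hr⟩ := IsLocalization.surj (nonZeroDivisors A) z
    have hr' : algebraMap A S r ∈ nonZeroDivisors S := by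
      rw [mem_nonZeroDivisors_iff_right]
      intro s hs
      have : (s : Q) * algebraMap A Q r = 0 := congrArg Subtype.val hs
      exact Subtype.ext ((IsLocalization.map_units Q r).mul_left_eq_zero.1 this)
    exact ⟨⟨algebraMap A S a, ⟨_, hr'⟩⟩, hr⟩
  · rw [Subtype.ext (h : (a : Q) = b)]

end FractionRing

/-! ### The conductor of a finite birational extension -/

section Birational

section

variable {R : Type u} [CommRing R] {Q : Type v} [CommRing Q] [Algebra R Q] {S : Subalgebra R Q}

theorem mul_mem_conductor {s c : Q} (hs : s ∈ S)
    (hc : c ∈ (1 : Submodule R Q) / Subalgebra.toSubmodule S) :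
    s * c ∈ (1 : Submodule R Q) / Subalgebra.toSubmodule S := by
  rw [Submodule.mem_div_iff_forall_mul_mem] at hc ⊢
  intro t ht
  have := hc (s * t) (S.mul_mem hs ht)
  rwa [mul_left_comm, ← mul_assoc] at this

theorem mem_one_of_mem_conductor {c : Q}
    (hc : c ∈ (1 : Submodule R Q) / Subalgebra.toSubmodule S) : c ∈ (1 : Submodule R Q) := by
  have := Submodule.mem_div_iff_forall_mul_mem.1 hc 1 (one_mem S)
  rwa [mul_one] at this

end

variable {R : Type u} [CommRing R] {Q : Type v} [CommRing Q] [Algebra R Q] [IsFractionRing R Q]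
  (S : Subalgebra R Q)

theorem Subalgebra.exists_common_denominator [Module.Finite R S] :
    ∃ d ∈ nonZeroDivisors R, ∀ s ∈ S, ∃ a, algebraMap R Q a = algebraMap R Q d * s := by
  obtain ⟨g, hg⟩ : (Subalgebra.toSubmodule S).FG := Module.Finite.iff_fg.1 ‹_›
  obtain ⟨d, hd⟩ := IsLocalization.exist_integer_multiples_of_finset (nonZeroDivisors R) g
  refine ⟨d, d.2, fun s hs => ?_⟩
  have hle : Subalgebra.toSubmodule S ≤ (LinearMap.range (Algebra.linearMap R Q)).comap
      (LinearMap.lsmul R Q d) := by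
    rw [← hg, Submodule.span_le]
    intro z hz
    obtain ⟨a, ha⟩ := hd z hz
    exact ⟨a, ha⟩
  obtain ⟨a, ha⟩ := hle hs
  exact ⟨a, ha.trans (Algebra.smul_def _ _)⟩

/-- `Hom_R(S, R)` is the conductor of `S`, as a submodule of the total ring of fractions. -/
noncomputable def conductorEquivDual :
    ((1 : Submodule R Q) / Subalgebra.toSubmodule S : Submodule R Q) ≃ₗ[R] (S →ₗ[R] R) :=
  (divEquivLinearMap (Subalgebra.toSubmodule S) 1 (one_mem (nonZeroDivisors R))
    (by rw [map_one]; exact one_mem S)).trans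
    (LinearEquiv.congrRight ((LinearEquiv.ofEq _ _ Submodule.one_eq_range).trans
      (LinearEquiv.ofInjective (Algebra.linearMap R Q) (IsFractionRing.injective R Q)).symm))

/-- The conductor ideal of `R` is isomorphic to its image in the total ring of fractions. -/
noncomputable def birationalConductorEquiv : birationalConductor S ≃ₗ[R]
    ((1 : Submodule R Q) / Subalgebra.toSubmodule S : Submodule R Q) :=
  (Submodule.equivMapOfInjective (Algebra.linearMap R Q) (IsFractionRing.injective R Q) _).trans
    (LinearEquiv.ofEq _ _ (map_birationalConductor S))

variable {S}

/-- If qC ⊆ C then qC ⊆ R, so q lies in the double dual of S, which is S. -/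
theorem conductor_div_conductor [Module.Finite R S]
    (hR : ∀ y ∈ nonZeroDivisors R, IsDivisorialAt y) :
    ((1 : Submodule R Q) / Subalgebra.toSubmodule S) / (1 / Subalgebra.toSubmodule S) =
      Subalgebra.toSubmodule S := by
  obtain ⟨d, hd, hdS⟩ := S.exists_common_denominator
  refine le_antisymm (fun q hq => one_div_one_div_le hR (Subalgebra.toSubmodule S) hd hdS
    (one_mem _) (by rw [map_one]; exact one_mem S) ?_) fun s hs => ?_
  · rw [Submodule.mem_div_iff_forall_mul_mem] at hq ⊢
    exact fun c hc => mem_one_of_mem_conductor (hq c hc)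
  · rw [Submodule.mem_div_iff_forall_mul_mem]
    exact fun c hc => mul_mem_conductor hs hc

theorem exists_algebraMap_mem_conductor [Module.Finite R S] : ∃ d ∈ nonZeroDivisors R,
    algebraMap R Q d ∈ (1 : Submodule R Q) / Subalgebra.toSubmodule S := by
  obtain ⟨d, hd, hdS⟩ := S.exists_common_denominator
  refine ⟨d, hd, ?_⟩
  rw [Submodule.mem_div_iff_forall_mul_mem]
  intro s hs
  obtain ⟨a, ha⟩ := hdS s hs
  exact Submodule.mem_one.2 ⟨a, ha⟩

theorem nonempty_equiv_dual_iff : Nonempty (S ≃ₗ[R] (S →ₗ[R] R)) ↔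
    Nonempty (S ≃ₗ[R] ((1 : Submodule R Q) / Subalgebra.toSubmodule S : Submodule R Q)) :=
  ⟨fun ⟨e⟩ => ⟨e.trans (conductorEquivDual S).symm⟩, fun ⟨e⟩ => ⟨e.trans (conductorEquivDual S)⟩⟩

/-- Hom(C, C) is C : C = S, and a common denominator of S supplies the non-zero-divisor in C. -/
theorem isStableIdeal_birationalConductor_iff [Module.Finite R S]
    (hR : ∀ y ∈ nonZeroDivisors R, IsDivisorialAt y) :
    IsStableIdeal (birationalConductor S) ↔
    Nonempty (S ≃ₗ[R] ((1 : Submodule R Q) / Subalgebra.toSubmodule S : Submodule R Q)) := by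
  obtain ⟨d, hd, hdC⟩ := exists_algebraMap_mem_conductor (S := S)
  let e := birationalConductorEquiv S
  let e' : S ≃ₗ[R] (birationalConductor S →ₗ[R] birationalConductor S) :=
    ((LinearEquiv.ofEq _ _ (conductor_div_conductor hR).symm).trans
      (divEquivLinearMap _ _ hd hdC)).trans (LinearEquiv.arrowCongr e e).symm
  exact ⟨fun h => ⟨(e'.trans h.iso.some.symm).trans e⟩,
    fun ⟨f⟩ => ⟨⟨d, hdC, hd⟩, ⟨(e.trans f.symm).trans e'⟩⟩⟩

theorem exists_algebraMap_eq_mul {y : S} (hy : y ∈ nonZeroDivisors S) :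
    ∃ r ∈ nonZeroDivisors R, ∃ s : S, algebraMap R S r = s * y := by
  have := S.isFractionRing
  obtain ⟨u, hu⟩ := IsLocalization.map_units Q (⟨y, hy⟩ : nonZeroDivisors S)
  obtain ⟨⟨a, r⟩, hr⟩ := IsLocalization.surj (nonZeroDivisors R) (↑u⁻¹ : Q)
  refine ⟨r, r.2, algebraMap R S a, Subtype.ext ?_⟩
  change algebraMap R Q r = algebraMap R Q a * (y : Q)
  have hu' : (u : Q) = y := hu
  rw [← hr, ← hu']
  linear_combination -(algebraMap R Q r) * u.inv_mul

theorem algebraMap_mem_nonZeroDivisors {r : R} (hr : r ∈ nonZeroDivisors R) :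
    algebraMap R S r ∈ nonZeroDivisors S := by
  rw [mem_nonZeroDivisors_iff_right]
  intro s hs
  have : (s : Q) * algebraMap R Q r = 0 := congrArg Subtype.val hs
  exact Subtype.ext ((IsLocalization.map_units Q ⟨r, hr⟩).mul_left_eq_zero.1 this)

/-- If the conductor is a principal fractional ideal of `S`, then `S` inherits from `R` that all
regular ideals are divisorial. -/
theorem isDivisorialAt_of_equiv_conductor [Module.Finite R S]
    (hR : ∀ y ∈ nonZeroDivisors R, IsDivisorialAt y)
    (e : S ≃ₗ[R] ((1 : Submodule R Q) / Subalgebra.toSubmodule S : Submodule R Q))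
    {y : S} (hy : y ∈ nonZeroDivisors S) : IsDivisorialAt y := by
  have hfrac := S.isFractionRing
  have he (s : S) : (e s : Q) = s * (e 1 : Q) := by
    obtain ⟨⟨a, r⟩, hr⟩ := IsLocalization.surj (nonZeroDivisors R) (s : Q)
    dsimp only at hr
    have h1 : (r : R) • s = a • (1 : S) := by
      apply Subtype.ext
      change (r : R) • (s : Q) = a • (1 : Q)
      rw [Algebra.smul_def, Algebra.smul_def, mul_one, ← hr, mul_comm]
    have h2 := congrArg (fun z : S => (e z : Q)) h1
    simp only [map_smul, Submodule.coe_smul] at h2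
    rw [Algebra.smul_def, Algebra.smul_def] at h2
    apply (IsLocalization.map_units Q r).mul_left_cancel
    linear_combination h2 - (e 1 : Q) * hr
  obtain ⟨d, hd, hdC⟩ := exists_algebraMap_mem_conductor (S := S)
  have hq : IsUnit (e 1 : Q) := by
    obtain ⟨s, hs⟩ := e.surjective ⟨_, hdC⟩
    have h1 : (s : Q) * (e 1 : Q) = algebraMap R Q d := by rw [← he, hs]
    exact isUnit_of_mul_isUnit_right (h1 ▸ IsLocalization.map_units Q ⟨d, hd⟩)
  obtain ⟨q, hq⟩ := hq
  have hmem {t : Q} (ht : t ∈ (1 : Submodule R Q) / Subalgebra.toSubmodule S) :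
      ∃ s : S, t = s * q := by
    obtain ⟨s, hs⟩ := e.surjective ⟨t, ht⟩
    exact ⟨s, by rw [hq, ← he, hs]⟩
  obtain ⟨b, hb⟩ := IsLocalization.map_units Q (⟨y, hy⟩ : nonZeroDivisors S)
  replace hb : (b : Q) = y := hb
  intro I hyI a ha
  let F : Submodule R Q := (I.restrictScalars R).map S.val.toLinearMap
  have hF {z : Q} : z ∈ F ↔ ∃ i ∈ I, (i : Q) = z := Iff.rfl
  suffices (a : Q) ∈ F by
    obtain ⟨i, hi, hia⟩ := hF.1 this
    exact Subtype.ext hia ▸ hi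
  obtain ⟨r, hr, s, hs⟩ := exists_algebraMap_eq_mul hy
  obtain ⟨d', hd', hdS⟩ := S.exists_common_denominator
  refine one_div_one_div_le hR F hd' (fun f hf => ?_) hr
    (hF.2 ⟨algebraMap R S r, hs ▸ I.mul_mem_left s hyI, rfl⟩) ?_
  · obtain ⟨i, -, rfl⟩ := hF.1 hf
    exact hdS i i.2
  rw [Submodule.mem_div_iff_forall_mul_mem]
  intro t ht
  rw [Submodule.mem_div_iff_forall_mul_mem] at ht
  -- Since I is an S-ideal, tI ⊆ R already forces tI ⊆ C = Sq. This turns R-duals into S-duals.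
  have hconv {z : S} (hz : z ∈ I) :
      t * z ∈ (1 : Submodule R Q) / Subalgebra.toSubmodule S := by
    rw [Submodule.mem_div_iff_forall_mul_mem]
    intro s' hs'
    rw [mul_assoc]
    exact ht _ (hF.2 ⟨z * ⟨s', hs'⟩, I.mul_mem_right _ hz, rfl⟩)
  -- With c = ty/q one has cI ⊆ yS, so the hypothesis on a gives ca ∈ yS, that is, ta ∈ Sq = C ⊆ R.
  obtain ⟨c, hc⟩ := hmem (hconv hyI)
  obtain ⟨g, hg⟩ := ha c fun i hi => by
    obtain ⟨g, hg⟩ := hmem (hconv hi)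
    refine ⟨g, Subtype.ext ?_⟩
    change (c : Q) * i = y * g
    apply q.isUnit.mul_left_cancel
    linear_combination (y : Q) * hg - (i : Q) * hc
  have hg' : (c : Q) * a = y * g := congrArg Subtype.val hg
  have hta : (a : Q) * t = g * (e 1 : Q) := by
    apply b.isUnit.mul_left_cancel
    rw [hb, ← hq]
    linear_combination (a : Q) * hc + (q : Q) * hg'
  rw [hta, ← he]
  exact mem_one_of_mem_conductor (e g).2

/-- If all regular ideals of `R` and of `S` are divisorial and `S` has finitely many maximal
ideals, then the conductor is isomorphic to `S`. -/
theorem nonempty_equiv_conductor [Module.Finite R S]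
    (hR : ∀ y ∈ nonZeroDivisors R, IsDivisorialAt y)
    (hS : ∀ y ∈ nonZeroDivisors S, IsDivisorialAt y)
    (hfin : {m : Ideal S | m.IsMaximal}.Finite) :
    Nonempty (S ≃ₗ[R] ((1 : Submodule R Q) / Subalgebra.toSubmodule S : Submodule R Q)) := by
  have hfrac := S.isFractionRing
  obtain ⟨d, hd, hdC⟩ := exists_algebraMap_mem_conductor (S := S)
  have hdS : algebraMap R S d ∈ nonZeroDivisors S := algebraMap_mem_nonZeroDivisors hd
  let C : Submodule S Q :=
    { ((1 : Submodule R Q) / Subalgebra.toSubmodule S : Submodule R Q).toAddSubmonoid with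
      smul_mem' := fun s c hc => mul_mem_conductor s.2 hc }
  have hC {c : Q} : c ∈ C ↔ c ∈ (1 : Submodule R Q) / Subalgebra.toSubmodule S := Iff.rfl
  have hone {z : Q} : z ∈ (1 : Submodule S Q) ↔ z ∈ S :=
    Submodule.mem_one.trans ⟨fun ⟨s, hs⟩ => hs ▸ s.2, fun h => ⟨⟨z, h⟩, rfl⟩⟩
  have hC1 : C ≤ 1 := fun c hc => by
    obtain ⟨a, rfl⟩ := Submodule.mem_one.1 (mem_one_of_mem_conductor (hC.1 hc))
    exact hone.2 (S.algebraMap_mem a)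
  have hdC' : algebraMap S Q (algebraMap R S d) ∈ C := hdC
  have hreflC : (1 : Submodule S Q) / (1 / C) ≤ C :=
    one_div_one_div_le hS C (one_mem _) (fun f hf => by
      simpa using Submodule.mem_one.1 (hC1 hf)) hdS hdC'
  let J := C * (1 / C)
  have hJ1 : J ≤ 1 := by
    rw [Submodule.mul_le]
    intro c hc t ht
    rw [mul_comm]
    exact Submodule.mem_div_iff_forall_mul_mem.1 ht c hc
  have h1C : (1 : Q) ∈ 1 / C := by
    rw [Submodule.mem_div_iff_forall_mul_mem]
    intro c hc
    rw [one_mul]; exact hC1 hc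
  -- By adjunction S : J = (S : (S : C)) : C, which is C : C = S because C is divisorial over S.
  have hJdiv : 1 / J ≤ 1 := by
    intro t ht
    rw [Submodule.mem_div_iff_forall_mul_mem] at ht
    have : t ∈ ((1 : Submodule R Q) / Subalgebra.toSubmodule S) /
        (1 / Subalgebra.toSubmodule S) := by
      rw [Submodule.mem_div_iff_forall_mul_mem]
      intro c hc
      refine hreflC ?_
      rw [Submodule.mem_div_iff_forall_mul_mem]
      intro z hz
      rw [mul_assoc]
      exact ht _ (Submodule.mul_mem_mul hc hz)
    rw [conductor_div_conductor hR] at this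
    exact hone.2 this
  have hJ : J = 1 := by
    refine le_antisymm hJ1 ?_
    rw [Submodule.one_le]
    refine one_div_one_div_le hS J (one_mem _) (fun f hf => by
      simpa using Submodule.mem_one.1 (hJ1 hf)) hdS
      (by simpa using Submodule.mul_mem_mul hdC' h1C) ?_
    rw [Submodule.mem_div_iff_forall_mul_mem]
    intro t ht
    rw [one_mul]; exact hJdiv ht
  let I₁ : FractionalIdeal (nonZeroDivisors S) Q := ⟨C, 1, one_mem _, fun c hc => by
    rw [one_smul]; exact Submodule.mem_one.1 (hC1 hc)⟩
  let I₂ : FractionalIdeal (nonZeroDivisors S) Q := ⟨1 / C, _, hdS, fun t ht => by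
    rw [Algebra.smul_def, mul_comm]
    exact Submodule.mem_one.1 (Submodule.mem_div_iff_forall_mul_mem.1 ht _ hdC')⟩
  have hmul : I₁ * I₂ = 1 := by
    rw [← FractionalIdeal.coeToSubmodule_inj, FractionalIdeal.coe_mul, FractionalIdeal.coe_one]
    exact hJ
  -- Over a semilocal ring an invertible fractional ideal is principal.
  obtain ⟨q, hq⟩ := FractionalIdeal.isPrincipal.of_finite_maximals_of_inv le_rfl hfin I₁ I₂ hmul
  replace hq : C = Submodule.span S {q} := hq
  have hmem {z : Q} : z ∈ C ↔ ∃ s : S, (s : Q) * q = z := by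
    rw [hq, Submodule.mem_span_singleton]; rfl
  have hqu : IsUnit q := by
    obtain ⟨s, hs⟩ := hmem.1 hdC'
    exact isUnit_of_mul_isUnit_right (hs ▸ IsLocalization.map_units Q ⟨d, hd⟩)
  exact ⟨LinearEquiv.ofBijective
    (((LinearMap.mulRight R q).restrict (p := Subalgebra.toSubmodule S)
      (q := (1 : Submodule R Q) / Subalgebra.toSubmodule S)
      fun s hs => hmem.2 ⟨⟨s, hs⟩, rfl⟩) :
      S →ₗ[R] ((1 : Submodule R Q) / Subalgebra.toSubmodule S : Submodule R Q))
    ⟨fun s t hst => Subtype.ext (hqu.mul_right_cancel (congrArg Subtype.val hst)), fun z => by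
      obtain ⟨s, hs⟩ := hmem.1 (hC.2 z.2)
      exact ⟨s, Subtype.ext hs⟩⟩⟩

end Birational

/-! ### The equivalence -/

theorem mainTheorem6 {R : Type u} [CommRing R] (hR : IsGorensteinLocalRing R)
    (hdim : ringKrullDim R = 1)
    {Q : Type v} [CommRing Q] [Algebra R Q] [IsFractionRing R Q]
    (S : Subalgebra R Q) (hS : Module.Finite R S) :
    [IsGorensteinRing S,
      Nonempty (S ≃ₗ[R] (S →ₗ[R] R)),
      IsStableIdeal (birationalConductor S)].TFAE := by
  have := hR.isLocalRing
  have := hR.isNoetherianRing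
  have : Ring.KrullDimLE 1 R := Ring.krullDimLE_iff.2 (by rw [hdim]; rfl)
  have hRdiv (y : R) (hy : y ∈ nonZeroDivisors R) : IsDivisorialAt y :=
    hR.isDivisorialAt hy (Ideal.isMaximal_of_mem_nonZeroDivisors hy)
  have hmax (m : Ideal S) (hm : m.IsMaximal) : (m.comap (algebraMap R S)).IsMaximal :=
    Ideal.isMaximal_comap_of_isIntegral_of_isMaximal m
  rw [nonempty_equiv_dual_iff, isStableIdeal_birationalConductor_iff hRdiv]
  tfae_have 2 ↔ 3 := Iff.rfl
  tfae_have 1 → 2 := by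
    intro h
    refine nonempty_equiv_conductor hRdiv (fun y hy => h.isDivisorialAt hy fun p hp hyp => ?_) ?_
    · obtain ⟨r, hr, s, hs⟩ := exists_algebraMap_eq_mul hy
      have hrp : r ∈ p.comap (algebraMap R S) := by
        rw [Ideal.mem_comap, hs]; exact p.mul_mem_left s hyp
      exact Ideal.isMaximal_of_isIntegral_of_isMaximal_comap p
        (Ideal.isMaximal_of_mem_nonZeroDivisors hr _ (hp.comap _) hrp)
    · refine (Algebra.QuasiFinite.finite_primesOver (S := S)
        (IsLocalRing.maximalIdeal R)).subset fun m hm => ?_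
      exact ⟨Ideal.IsMaximal.isPrime hm, ⟨(IsLocalRing.eq_maximalIdeal (hmax m hm)).symm⟩⟩
  tfae_have 2 → 1 := by
    rintro ⟨e⟩
    have : IsNoetherianRing S := IsNoetherianRing.of_finite R S
    -- Maximal ideals of S contract to the maximal ideal of R by integrality, so x lies in the
    -- Jacobson radical of S.
    obtain ⟨x, hx, hxm⟩ := hR.exists_nonZeroDivisor hdim
    have hxS : algebraMap R S x ∈ nonZeroDivisors S := algebraMap_mem_nonZeroDivisors hx
    have : HasInjectiveDimensionLE (ModuleCat.of S S) 1 :=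
      IsDivisorialAt.hasInjectiveDimensionLE hxS
        (Ideal.mem_sInf.2 fun {m} hm => hxm _ (hmax m hm.2))
        fun n => isDivisorialAt_of_equiv_conductor hRdiv e (pow_mem hxS n)
    exact isGorensteinRing_of_hasInjectiveDimensionLE (n := 1)
  tfae_finish
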